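/- Let $T>0$, $\omega=2\pi/T$, $n\in\mathbb N$; let $A:\mathbb R\to\mathbb R^{n\times n}$ and $Q:\mathbb R\to\mathbb C^{n\times n}$ be $T$-periodic and of class $L^\infty$. For a $T$-periodic $L^\infty$ matrix function $P$ let $P_{ij,k}=\frac1T\int_0^T P_{ij}(t)e^{-\mathrm i\omega kt}\,dt$ be its phasors, let $\mathcal T(P)$ be the $n\times n$ block matrix whose block $(i,j)$ is the infinite Toeplitz matrix $(P_{ij,k-l})_{k,l\in\mathbb Z}$, and let $\mathrm{col}(\mathbf P)$ be the vector of all phasors obtained by stacking the columns of $\mathbf P=(P_{ij,k})$. Put $\mathcal A=\mathcal T(A)$, $\mathcal Q=\mathcal T(Q)$, $\mathcal N=\mathrm{Id}_n\otimes\mathrm{diag}(\mathrm i\omega k)_{k\in\mathbb Z}$, and write $\mathrm{Id}_n\circ\mathcal M$ for the block matrix with blocks $\mathrm{Id}_n\otimes\mathcal M_{ij}$. Let $\mathcal A_m,\mathcal N_m$ be obtained from $\mathcal A,\mathcal N$ by keeping in every block only the indices $|k|,|l|\le m$, and let $\mathbf Q|_m$ consist of the phasors of $Q$ of order $|k|\le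 m$. Assume that $\mathcal A-\mathcal N$, on the domain $\{X\in\ell^2:(\mathcal A-\mathcal N)X\in\ell^2\}$, is invertible with bounded inverse on $\ell^2$, and that the harmonic Lyapunov equation $$\mathcal T(P)(\mathcal A-\mathcal N)+(\mathcal A-\mathcal N)^*\,\mathcal T(P)+\mathcal Q=0,\qquad P\in L^\infty,\ P\ T\text{-periodic},\tag{1}$$ satisfies uniqueness, i.e. for $Q=0$ its only solution is $P=0$ a.e. Then (1) has exactly one solution $P$ (up to a.e. equality); the operator $\mathrm{Id}_n\otimes(\mathcal A-\mathcal N)^*+\mathrm{Id}_n\circ\mathcal A^*$ is invertible on $\ell^2$ with bounded inverse, and $$\mathrm{col}(\mathbf P)=-\bigl(\mathrm{Id}_n\otimes(\mathcal A-\mathcal N)^*+\mathrm{Id}_n\circ\mathcal A^*\bigr)^{-1}\mathrm{col}(\mathbf Q).$$ Moreover, for every $\varepsilon>0$ there is $m_0$ such that for all $m\ge m_0$ the matrix $\mathrm{Id}_n\otimes(\mathcal A_m-\mathcal N_m)^*+\mathrm{Id}_n\circ\mathcal A_m^*$, of size $n^2(2m+1)$, is invertible, and the truncated solution $$\mathrm{col}(\tilde{\mathbf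 P}_m):=-\bigl(\mathrm{Id}_n\otimes(\mathcal A_m-\mathcal N_m)^*+\mathrm{Id}_n\circ\mathcal A_m^*\bigr)^{-1}\mathrm{col}(\mathbf Q|_m),$$ extended by $0$ to the phasors of order $|k|>m$, satisfies $$\|\mathrm{col}(\mathbf P-\tilde{\mathbf P}_m)\|_{\ell^2}<\varepsilon ;$$ and, with $\tilde P_m(t)=\sum_{|k|\le m}(\tilde{\mathbf P}_m)_k e^{\mathrm i\omega kt}$, the matrices $\mathcal T(P)$ and $\mathcal T(\tilde P_m)$ define bounded operators on $\ell^2$ with $$\|\mathcal T(P)-\mathcal T(\tilde P_m)\|_{\ell^2}<\varepsilon .$$ -/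

import Mathlib

open MeasureTheory
open scoped ENNReal Matrix Kronecker

namespace Harmonic

noncomputable section

/-- The complex Hilbert space `ℓ²` of square-summable families indexed by `κ`. -/
abbrev Ell2 (κ : Type) : Type := lp (fun _ : κ => ℂ) 2

/-- The (possibly infinite) matrix `M` sends the family `x` to the family `y`:
for every row `p`, the series `∑ q, M p q * x q` converges with sum `y p`. -/
def ActsTo {κ : Type} (M : Matrix κ κ ℂ) (x y : κ → ℂ) : Prop :=
  ∀ p, HasSum (fun q => M p q * x q) (y p)

/-- `L` is the bounded operator on `ℓ²` whose matrix is `M`. -/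
def IsOperatorOf {κ : Type} (M : Matrix κ κ ℂ) (L : Ell2 κ →L[ℂ] Ell2 κ) : Prop :=
  ∀ x : Ell2 κ, ActsTo M x (L x)

/-- Invertibility of the (possibly unbounded) operator on `ℓ²` defined by the matrix `M` on its
maximal domain `{x ∈ ℓ² : M x ∈ ℓ²}`: it has a bounded two-sided inverse `R : ℓ² → ℓ²`. -/
def IsInvertibleOp {κ : Type} (M : Matrix κ κ ℂ) : Prop :=
  ∃ R : Ell2 κ →L[ℂ] Ell2 κ,
    (∀ y : Ell2 κ, ActsTo M (R y) y) ∧ ∀ x y : Ell2 κ, ActsTo M x y → R y = x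

/-- `U` is the product `M * N` of two infinite matrices: every entry is a convergent series. -/
def IsProd {κ : Type} (M N U : Matrix κ κ ℂ) : Prop :=
  ∀ p q, HasSum (fun r => M p r * N r q) (U p q)

/-- Index set `{k ∈ ℤ : |k| ≤ m}` of the harmonics kept by the `m`-truncation. -/
abbrev Idx (m : ℕ) : Type := ↥(Finset.Icc (-(m : ℤ)) (m : ℤ))

variable {T : ℝ} [hT : Fact (0 < T)] {n : ℕ}

/-- A `T`-periodic matrix function (a function on the circle `ℝ / Tℤ`) of class `L^∞`. -/
def IsLInfty (P : AddCircle T → Matrix (Fin n) (Fin n) ℂ) : Prop :=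
  ∀ i j, MemLp (fun t => P t i j) ∞ (AddCircle.haarAddCircle (T := T))

/-- The complexification of a real matrix function. -/
def toC (A : AddCircle T → Matrix (Fin n) (Fin n) ℝ) : AddCircle T → Matrix (Fin n) (Fin n) ℂ :=
  fun t => (A t).map Complex.ofReal

/-- The `k`-th phasor `(1/T) ∫_0^T P i j (t) exp (-i ω k t) dt` of the entry `(i, j)`. -/
def phasor (P : AddCircle T → Matrix (Fin n) (Fin n) ℂ) (i j : Fin n) (k : ℤ) : ℂ :=
  fourierCoeff (fun t => P t i j) k

/-- The `n × n` block Toeplitz matrix `𝒯(P)`: the block `(i, j)` has entry `P_{ij, k - l}` at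
position `(k, l)`. -/
def toeplitz (P : AddCircle T → Matrix (Fin n) (Fin n) ℂ) :
    Matrix (Fin n × ℤ) (Fin n × ℤ) ℂ :=
  fun p q => phasor P p.1 q.1 (p.2 - q.2)

/-- `𝒩 = Id_n ⊗ diag (i ω k, k ∈ ℤ)` with `ω = 2 π / T`. -/
def nMat (T : ℝ) (n : ℕ) : Matrix (Fin n × ℤ) (Fin n × ℤ) ℂ :=
  (1 : Matrix (Fin n) (Fin n) ℂ) ⊗ₖ
    Matrix.diagonal (fun k : ℤ => Complex.I * ((2 * Real.pi / T : ℝ) : ℂ) * (k : ℂ))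

/-- `P`, of class `L^∞`, solves the harmonic Lyapunov equation
`𝒫 (𝒜 - 𝒩) + (𝒜 - 𝒩)ᴴ 𝒫 + 𝒬 = 0`, where `𝒜 = 𝒯(A)`, `𝒫 = 𝒯(P)`, `𝒬 = 𝒯(Q)`. -/
def IsLyapSol (A : AddCircle T → Matrix (Fin n) (Fin n) ℝ)
    (Q P : AddCircle T → Matrix (Fin n) (Fin n) ℂ) : Prop :=
  IsLInfty P ∧ ∃ U V : Matrix (Fin n × ℤ) (Fin n × ℤ) ℂ,
    IsProd (toeplitz P) (toeplitz (toC A) - nMat T n) U ∧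
    IsProd (toeplitz (toC A) - nMat T n)ᴴ (toeplitz P) V ∧
    U + V + toeplitz Q = 0

/-- `Id_n ∘ M`: the block matrix whose block `(j, j')` is `Id_n ⊗ M_{j j'}`, where `M_{j j'}`
are the blocks of `M`. -/
def idCirc {κ : Type} (M : Matrix (Fin n × κ) (Fin n × κ) ℂ) :
    Matrix (Fin n × (Fin n × κ)) (Fin n × (Fin n × κ)) ℂ :=
  fun p q =>
    ((1 : Matrix (Fin n) (Fin n) ℂ) ⊗ₖ (Matrix.of fun k l : κ => M (p.1, k) (q.1, l))) p.2 q.2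

/-- `Id_n ⊗ (𝒜 - 𝒩)ᴴ + Id_n ∘ 𝒜ᴴ`, acting on the vectorised phasors. -/
def lyapMat {κ : Type} (𝒜 𝒩 : Matrix (Fin n × κ) (Fin n × κ) ℂ) :
    Matrix (Fin n × (Fin n × κ)) (Fin n × (Fin n × κ)) ℂ :=
  (1 : Matrix (Fin n) (Fin n) ℂ) ⊗ₖ (𝒜 - 𝒩)ᴴ + idCirc 𝒜ᴴ

/-- `col(𝐏)`: the columns of the matrix of phasors stacked; `(j, (i, k))` is the `k`-th phasor of
the entry in row `i` and column `j`. -/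
def colPhasor (P : AddCircle T → Matrix (Fin n) (Fin n) ℂ) : Fin n × (Fin n × ℤ) → ℂ :=
  fun p => phasor P p.2.1 p.1 p.2.2

/-- The `m`-truncation of an `n × n` block matrix (every block is truncated to `|k|, |l| ≤ m`). -/
def trunc (m : ℕ) (M : Matrix (Fin n × ℤ) (Fin n × ℤ) ℂ) :
    Matrix (Fin n × Idx m) (Fin n × Idx m) ℂ :=
  M.submatrix (fun p => (p.1, (p.2 : ℤ))) (fun p => (p.1, (p.2 : ℤ)))

/-- `Id_n ⊗ (𝒜_m - 𝒩_m)ᴴ + Id_n ∘ 𝒜_mᴴ`, a square matrix of size `n² (2 m + 1)`. -/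
def truncLyapMat (A : AddCircle T → Matrix (Fin n) (Fin n) ℝ) (m : ℕ) :
    Matrix (Fin n × (Fin n × Idx m)) (Fin n × (Fin n × Idx m)) ℂ :=
  lyapMat (trunc m (toeplitz (toC A))) (trunc m (nMat T n))

/-- The solution `- (Id_n ⊗ (𝒜_m - 𝒩_m)ᴴ + Id_n ∘ 𝒜_mᴴ)⁻¹ col(𝐐|_m)` of the truncated system. -/
def truncSol (A : AddCircle T → Matrix (Fin n) (Fin n) ℝ)
    (Q : AddCircle T → Matrix (Fin n) (Fin n) ℂ) (m : ℕ) : Fin n × (Fin n × Idx m) → ℂ :=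
  -((truncLyapMat A m)⁻¹ *ᵥ fun p => colPhasor Q (p.1, (p.2.1, (p.2.2 : ℤ))))

/-- `col(𝐏̃_m)`: the truncated solution, extended by `0` to the phasors of order `|k| > m`. -/
def truncPhasor (A : AddCircle T → Matrix (Fin n) (Fin n) ℝ)
    (Q : AddCircle T → Matrix (Fin n) (Fin n) ℂ) (m : ℕ) : Fin n × (Fin n × ℤ) → ℂ :=
  fun p => if h : p.2.2 ∈ Finset.Icc (-(m : ℤ)) (m : ℤ) then
    truncSol A Q m (p.1, (p.2.1, ⟨p.2.2, h⟩)) else 0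

/-- The trigonometric polynomial `P̃_m(t) = ∑_{|k| ≤ m} (𝐏̃_m)_k exp (i ω k t)`. -/
def truncFun (A : AddCircle T → Matrix (Fin n) (Fin n) ℝ)
    (Q : AddCircle T → Matrix (Fin n) (Fin n) ℂ) (m : ℕ) :
    AddCircle T → Matrix (Fin n) (Fin n) ℂ :=
  fun t => Matrix.of fun i j =>
    ∑ k ∈ Finset.Icc (-(m : ℤ)) (m : ℤ), truncPhasor A Q m (j, (i, k)) * fourier k t

end

end Harmonic

open Filter Topology

/-!
Vectorised, the Lyapunov equation reads `M x = -col(𝐐)` with `M = ℬ + diag (i ω k)`, where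
`ℬ = Id_n ⊗ 𝒜ᴴ + Id_n ∘ 𝒜ᴴ` is bounded on `ℓ²`. Multiplying by the sequence
`r = 1 / (1 + i ω k)` turns `M x = y` into `(1 + r (ℬ - 1)) x = r y`. Since `r` is in `ℓ²`,
multiplication by `r` is a compact operator from `ℓ²` to `ℓ¹`, so the preconditioned equation lives
in `ℓ¹` and its operator is a compact perturbation of the identity: by the Fredholm alternative it
is invertible as soon as it is injective. A vector of its kernel, being absolutely summable,
consists of the phasors of a continuous solution of the homogeneous equation, which vanishes by
uniqueness.

The `m`-truncated system is the same equation with `r` replaced by its restriction to `|k| ≤ m`.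
These restrictions converge to `r` in `ℓ²`, hence the preconditioned operators converge in norm and
the solutions converge in `ℓ¹`. The `ℓ¹` norm of the phasors dominates their `ℓ²` norm, and also the
sup norm of the matrix function, which controls the norm of its Toeplitz operator.
-/

namespace Harmonic

noncomputable section

section MatrixProducts

variable {κ : Type} {M N U V : Matrix κ κ ℂ} {x y z : κ → ℂ}

lemma ActsTo.add (hM : ActsTo M x y) (hN : ActsTo N x z) : ActsTo (M + N) x (y + z) := fun p => by
  simp only [Matrix.add_apply, add_mul]
  exact (hM p).add (hN p)

lemma ActsTo.actsTo_iff_eq (hy : ActsTo M x y) : ActsTo M x z ↔ y = z :=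
  ⟨fun hz => funext fun p => (hy p).unique (hz p), fun h => h ▸ hy⟩

lemma actsTo_diagonal [DecidableEq κ] (d x : κ → ℂ) : ActsTo (Matrix.diagonal d) x (d * x) :=
  fun p => by
    refine (hasSum_ite_eq p (d p * x p)).congr_fun fun q => ?_
    rcases eq_or_ne p q with rfl | h
    · simp
    · simp [h, h.symm]

lemma IsProd.eq (hU : IsProd M N U) (hV : IsProd M N V) : U = V :=
  Matrix.ext fun p q => (hU p q).unique (hV p q)

lemma IsProd.add_left {M' : Matrix κ κ ℂ} (h : IsProd M N U) (h' : IsProd M' N V) :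
    IsProd (M + M') N (U + V) := fun p q => by
  simp only [Matrix.add_apply, add_mul]
  exact (h p q).add (h' p q)

lemma IsProd.sub_right {N' : Matrix κ κ ℂ} (h : IsProd M N U) (h' : IsProd M N' V) :
    IsProd M (N - N') (U - V) := fun p q => by
  simp only [Matrix.sub_apply, mul_sub]
  exact (h p q).sub (h' p q)

lemma isProd_diagonal_left [DecidableEq κ] (d : κ → ℂ) (M : Matrix κ κ ℂ) :
    IsProd (Matrix.diagonal d) M (Matrix.of fun p q => d p * M p q) :=
  fun p q => actsTo_diagonal d (fun r => M r q) p

lemma isProd_diagonal_right [DecidableEq κ] (d : κ → ℂ) (M : Matrix κ κ ℂ) :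
    IsProd M (Matrix.diagonal d) (Matrix.of fun p q => M p q * d q) := fun p q => by
  refine (hasSum_ite_eq q (M p q * d q)).congr_fun fun r => ?_
  rcases eq_or_ne q r with rfl | h
  · simp
  · simp [h.symm]

end MatrixProducts

/-- The Banach space `ℓ¹` of absolutely summable complex families indexed by `κ`. -/
abbrev Ell1 (κ : Type) : Type := lp (fun _ : κ => ℂ) 1

section SequenceSpaces

variable {κ α : Type}

lemma ell2_hasSum_single [DecidableEq κ] (x : Ell2 κ) : HasSum (fun p => lp.single 2 p (x p)) x :=
  lp.hasSum_single (by simp) x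

lemma norm_linearMapOfLE_ell1_le (x : Ell1 κ) :
    ‖lp.linearMapOfLE ℂ (fun _ : κ => ℂ) one_le_two x‖ ≤ ‖x‖ := by
  classical
  have hnorm : HasSum (fun p => ‖x p‖) ‖x‖ := by
    simpa using lp.hasSum_norm (p := 1) (by simp) x
  refine (ell2_hasSum_single _).norm_le_of_bounded hnorm fun p => ?_
  rw [lp.norm_single (by simp), lp.coe_linearMapOfLE_apply]

/-- The inclusion `ℓ¹ ⊆ ℓ²`. -/
def ell1Incl (κ : Type) : Ell1 κ →L[ℂ] Ell2 κ :=
  (lp.linearMapOfLE ℂ (fun _ : κ => ℂ) one_le_two).mkContinuous 1 fun x => by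
    simpa only [one_mul] using norm_linearMapOfLE_ell1_le x

@[simp]
lemma ell1Incl_apply (x : Ell1 κ) (p : κ) : ell1Incl κ x p = x p := rfl

lemma coe_ell1Incl (x : Ell1 κ) : (ell1Incl κ x : κ → ℂ) = x := funext fun _ => rfl

/-- Entrywise multiplication `ℓ² × ℓ² → ℓ¹`. -/
def ell2Mul (κ : Type) : Ell2 κ →L[ℂ] Ell2 κ →L[ℂ] Ell1 κ :=
  lp.holderL 1 (fun _ : κ => ContinuousLinearMap.mul ℂ ℂ) (K := 1) fun _ => by simp

@[simp]
lemma ell2Mul_apply (r x : Ell2 κ) (p : κ) : ell2Mul κ r x p = r p * x p := rfl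

lemma ell2Mul_single [DecidableEq κ] (p : κ) (c : ℂ) :
    ell2Mul κ (lp.single 2 p c) =
      (lp.singleContinuousLinearMap ℂ (fun _ : κ => ℂ) 1 p ∘L ContinuousLinearMap.mul ℂ ℂ c) ∘L
        lp.evalCLM ℂ (fun _ : κ => ℂ) 2 p := by
  ext x q
  rcases eq_or_ne q p with rfl | hq
  · simp [lp.evalCLM]
  · simp [hq]

lemma isCompactOperator_ell2Mul (r : Ell2 κ) : IsCompactOperator (ell2Mul κ r) := by
  classical
  have hsum := (ell2_hasSum_single r).mapL (ell2Mul κ)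
  refine isCompactOperator_of_tendsto hsum (.of_forall fun s => ?_)
  refine (compactOperator (RingHom.id ℂ) (Ell2 κ) (Ell1 κ)).sum_mem fun p _ => ?_
  rw [ell2Mul_single]
  have heval : IsCompactOperator (lp.evalCLM ℂ (fun _ : κ => ℂ) 2 p) :=
    isCompactOperator_of_locallyCompactSpace_dom _
  exact heval.clm_comp (lp.singleContinuousLinearMap ℂ (fun _ : κ => ℂ) 1 p ∘L
    ContinuousLinearMap.mul ℂ ℂ (r p))

lemma memℓp_comp_embedding {p : ℝ≥0∞} [Fact (1 ≤ p)] (e : α ↪ κ) {x : κ → ℂ}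
    (hx : Memℓp x p) : Memℓp (x ∘ e) p := by
  rcases p.dichotomy with rfl | hp
  · exact memℓp_infty_iff.2 ((memℓp_infty_iff.1 hx).mono
      (Set.range_comp_subset_range e fun i => ‖x i‖))
  · have hp₀ := zero_lt_one.trans_le hp
    exact (memℓp_gen_iff hp₀).2 (((memℓp_gen_iff hp₀).1 hx).comp_injective e.injective)

lemma norm_comp_embedding_le {p : ℝ≥0∞} [Fact (1 ≤ p)] (e : α ↪ κ)
    (x : lp (fun _ : κ => ℂ) p) :
    ‖(⟨x ∘ e, memℓp_comp_embedding e x.2⟩ : lp (fun _ : α => ℂ) p)‖ ≤ ‖x‖ := by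
  rcases p.dichotomy with rfl | hp
  · exact lp.norm_le_of_forall_le (norm_nonneg x) fun a =>
      lp.norm_apply_le_norm (by simp) x (e a)
  · have hp₀ := zero_lt_one.trans_le hp
    refine lp.norm_le_of_forall_sum_le hp₀ (norm_nonneg x) fun s => ?_
    simpa using lp.sum_rpow_le_norm_rpow hp₀ x (s.map e)

/-- Restriction of a family in `ℓᵖ` along an embedding of index sets. -/
def lpRestrict (p : ℝ≥0∞) [Fact (1 ≤ p)] (e : α ↪ κ) :
    lp (fun _ : κ => ℂ) p →L[ℂ] lp (fun _ : α => ℂ) p :=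
  LinearMap.mkContinuous
    { toFun x := ⟨x ∘ e, memℓp_comp_embedding e x.2⟩
      map_add' _ _ := rfl
      map_smul' _ _ := rfl }
    1 fun x => (norm_comp_embedding_le e x).trans_eq (one_mul _).symm

@[simp]
lemma lpRestrict_apply (p : ℝ≥0∞) [Fact (1 ≤ p)] (e : α ↪ κ) (x : lp (fun _ : κ => ℂ) p)
    (a : α) : lpRestrict p e x a = x (e a) := rfl

end SequenceSpaces

section DiagonalPerturbation

variable {κ : Type} {M : Matrix κ κ ℂ} {r : Ell2 κ} {C : Ell2 κ →L[ℂ] Ell2 κ}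

/-- `M` is the sum of the bounded operator `C` and of a diagonal matrix whose entries have the
square-summable inverses `r`. -/
structure IsDiagPerturbation (M : Matrix κ κ ℂ) (r : Ell2 κ) (C : Ell2 κ →L[ℂ] Ell2 κ) :
    Prop where
  ne_zero : ∀ p, r p ≠ 0
  actsTo : ∀ x : Ell2 κ, ActsTo M x fun p => (r p)⁻¹ * x p + C x p

/-- The operator `1 + r C` on `ℓ¹`: the equation `(1 / r + C) x = y`, multiplied by `r`, becomes
`precond r C x = r y`. -/
def precond (r : Ell2 κ) (C : Ell2 κ →L[ℂ] Ell2 κ) : Ell1 κ →L[ℂ] Ell1 κ :=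
  1 + ell2Mul κ r ∘L C ∘L ell1Incl κ

lemma precond_apply (x : Ell1 κ) (p : κ) :
    precond r C x p = x p + r p * C (ell1Incl κ x) p := rfl

lemma precond_eq_iff (x : Ell1 κ) (y : Ell2 κ) :
    precond r C x = ell2Mul κ r y ↔ ∀ p, x p + r p * C (ell1Incl κ x) p = r p * y p := by
  refine ⟨fun h p => ?_, fun h => ?_⟩
  · rw [← precond_apply, h, ell2Mul_apply]
  · ext p
    rw [precond_apply, h, ell2Mul_apply]

lemma continuous_precond : Continuous fun r : Ell2 κ => precond r C := by
  unfold precond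
  fun_prop

/-- The solution in `ℓ¹` of `(1 / r + C) x = y`; meaningful only when `precond r C` is
invertible. -/
def precondSol (r : Ell2 κ) (C : Ell2 κ →L[ℂ] Ell2 κ) (y : Ell2 κ) : Ell1 κ :=
  Ring.inverse (precond r C) (ell2Mul κ r y)

lemma precond_precondSol (h : IsUnit (precond r C)) (y : Ell2 κ) :
    precond r C (precondSol r C y) = ell2Mul κ r y :=
  DFunLike.congr_fun (Ring.mul_inverse_cancel _ h) (ell2Mul κ r y)

lemma eq_precondSol (h : IsUnit (precond r C)) {x : Ell1 κ} {y : Ell2 κ}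
    (hx : precond r C x = ell2Mul κ r y) : x = precondSol r C y := by
  rw [precondSol, ← hx]
  exact (DFunLike.congr_fun (Ring.inverse_mul_cancel _ h) x).symm

lemma isUnit_precond_of_injective (h : ∀ x, precond r C x = 0 → x = 0) :
    IsUnit (precond r C) := by
  set K := ell2Mul κ r ∘L C ∘L ell1Incl κ
  have hcompact : IsCompactOperator (-K) :=
    ((isCompactOperator_ell2Mul r).comp_clm (C ∘L ell1Incl κ)).neg
  have hprecond : precond r C = algebraMap ℂ (Ell1 κ →L[ℂ] Ell1 κ) 1 - -K := by
    rw [map_one, sub_neg_eq_add, precond]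
  rcases hcompact.hasEigenvalue_or_mem_resolventSet one_ne_zero with heigen | hresolvent
  · obtain ⟨x, hx⟩ := heigen.exists_hasEigenvector
    refine absurd (h x ?_) hx.2
    have hKx : (-K) x = x := by simpa using hx.apply_eq_smul
    rw [hprecond, map_one, sub_apply, hKx]
    exact sub_self x
  · rwa [hprecond]

lemma continuousAt_precondSol (h : IsUnit (precond r C)) (y : Ell2 κ) :
    ContinuousAt (fun s => precondSol s C y) r := by
  have hinverse : ContinuousAt Ring.inverse (precond r C) := by
    obtain ⟨u, hu⟩ := h
    exact hu ▸ NormedRing.inverse_continuousAt u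
  exact ContinuousAt.clm_apply
    (ContinuousAt.comp (f := fun s => precond s C) hinverse continuous_precond.continuousAt)
    (by fun_prop)

namespace IsDiagPerturbation

variable (hM : IsDiagPerturbation M r C)
include hM

lemma inv_mul_add_eq_iff (p : κ) (a b c : ℂ) :
    (r p)⁻¹ * a + b = c ↔ a + r p * b = r p * c := by
  rw [← mul_right_inj' (hM.ne_zero p), mul_add, mul_inv_cancel_left₀ (hM.ne_zero p)]

lemma actsTo_iff (x y : Ell2 κ) : ActsTo M x y ↔ ∀ p, x p + r p * C x p = r p * y p := by
  simp only [← hM.inv_mul_add_eq_iff]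
  refine ⟨fun h p => (hM.actsTo x p).unique (h p), fun h p => ?_⟩
  rw [← h p]
  exact hM.actsTo x p

lemma actsTo_ell1Incl_iff (x : Ell1 κ) (y : Ell2 κ) :
    ActsTo M x y ↔ precond r C x = ell2Mul κ r y := by
  rw [← coe_ell1Incl, hM.actsTo_iff, precond_eq_iff]
  rfl

lemma exists_ell1Incl_eq {x y : Ell2 κ} (h : ActsTo M x y) : ∃ z : Ell1 κ, ell1Incl κ z = x := by
  refine ⟨ell2Mul κ r (y - C x), ?_⟩
  ext p
  have hp := (hM.actsTo_iff x y).1 h p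
  simp only [ell1Incl_apply, ell2Mul_apply, lp.coeFn_sub, Pi.sub_apply]
  linear_combination -hp

lemma isUnit_precond (hinj : ∀ x : Ell1 κ, ActsTo M x 0 → x = 0) : IsUnit (precond r C) :=
  isUnit_precond_of_injective fun x hx =>
    hinj x ((hM.actsTo_ell1Incl_iff x 0).2 (hx.trans (map_zero _).symm))

lemma actsTo_precondSol (h : IsUnit (precond r C)) (y : Ell2 κ) :
    ActsTo M (precondSol r C y) y :=
  (hM.actsTo_ell1Incl_iff _ y).2 (precond_precondSol h y)

lemma isInvertibleOp (h : IsUnit (precond r C)) : IsInvertibleOp M := by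
  let R := ell1Incl κ ∘L Ring.inverse (precond r C) ∘L ell2Mul κ r
  have hR (y : Ell2 κ) : R y = ell1Incl κ (precondSol r C y) := rfl
  refine ⟨R, fun y => ?_, fun x y hxy => ?_⟩
  · rw [hR, coe_ell1Incl]
    exact hM.actsTo_precondSol h y
  · obtain ⟨z, rfl⟩ := hM.exists_ell1Incl_eq hxy
    rw [coe_ell1Incl, hM.actsTo_ell1Incl_iff] at hxy
    rw [hR, ← eq_precondSol h hxy]

end IsDiagPerturbation

end DiagonalPerturbation

section FiniteSections

variable {κ α : Type} {e : α ↪ κ} {M : Matrix κ κ ℂ} {r : Ell2 κ} {C : Ell2 κ →L[ℂ] Ell2 κ}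

lemma exists_ell1_eq_on_range [Finite α] (v : α → ℂ) :
    ∃ x : Ell1 κ, ⇑x ∘ e = v ∧ ∀ p ∉ Set.range e, x p = 0 := by
  classical
  cases nonempty_fintype α
  refine ⟨∑ a, lp.single 1 (e a) (v a), ?_, fun p hp => ?_⟩
  · ext b
    simp only [lp.coeFn_sum, Function.comp_apply, Finset.sum_apply, lp.single_apply,
      Pi.single_apply, e.injective.eq_iff, Finset.sum_ite_eq, Finset.mem_univ, if_true]
  · simp only [lp.coeFn_sum, Finset.sum_apply]
    exact Finset.sum_eq_zero fun a _ => lp.single_apply_ne _ _ _ fun h => hp ⟨a, h.symm⟩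

variable [Fintype α]

lemma submatrix_mulVec_eq_of_actsTo {x y : κ → ℂ} (h : ActsTo M x y)
    (hx : ∀ p ∉ Set.range e, x p = 0) : M.submatrix e e *ᵥ (x ∘ e) = y ∘ e := by
  ext a
  have hrow := (e.injective.hasSum_iff fun p hp => by rw [hx p hp, mul_zero]).2 (h (e a))
  exact (hasSum_fintype _).unique hrow

variable [DecidableEq κ]

/-- The part of a square-summable family supported on a finite set of indices. -/
def ell2Truncate (s : Finset κ) (r : Ell2 κ) : Ell2 κ := ∑ p ∈ s, lp.single 2 p (r p)

lemma ell2Truncate_apply (s : Finset κ) (r : Ell2 κ) (p : κ) :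
    ell2Truncate s r p = if p ∈ s then r p else 0 := by
  simp only [ell2Truncate, lp.coeFn_sum, Finset.sum_apply, lp.single_apply, Finset.sum_pi_single]

lemma tendsto_ell2Truncate (r : Ell2 κ) :
    Tendsto (fun s => ell2Truncate s r) atTop (𝓝 r) :=
  ell2_hasSum_single r

lemma eventually_isUnit_precond_ell2Truncate (h : IsUnit (precond r C)) :
    ∀ᶠ s in atTop, IsUnit (precond (ell2Truncate s r) C) :=
  ((continuous_precond.tendsto r).comp (tendsto_ell2Truncate r)).eventually
    (Units.isOpen.mem_nhds h)

lemma tendsto_precondSol_ell2Truncate (h : IsUnit (precond r C)) (y : Ell2 κ) :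
    Tendsto (fun s => precondSol (ell2Truncate s r) C y) atTop (𝓝 (precondSol r C y)) :=
  (continuousAt_precondSol h y).tendsto.comp (tendsto_ell2Truncate r)

namespace IsDiagPerturbation

variable (hM : IsDiagPerturbation M r C)
include hM

lemma precond_ell2Truncate_eq_iff (x : Ell1 κ) (y : Ell2 κ) :
    precond (ell2Truncate (Finset.univ.map e) r) C x =
        ell2Mul κ (ell2Truncate (Finset.univ.map e) r) y ↔
      (∀ p ∉ Set.range e, x p = 0) ∧ M.submatrix e e *ᵥ (⇑x ∘ e) = ⇑y ∘ e := by
  have hsplit : (precond (ell2Truncate (Finset.univ.map e) r) C x =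
        ell2Mul κ (ell2Truncate (Finset.univ.map e) r) y) ↔
      (∀ p ∉ Set.range e, x p = 0) ∧
        ∀ a, (r (e a))⁻¹ * x (e a) + C (ell1Incl κ x) (e a) = y (e a) := by
    simp only [precond_eq_iff, ell2Truncate_apply, hM.inv_mul_add_eq_iff]
    refine ⟨fun h => ⟨fun p hp => ?_, fun a => by simpa using h (e a)⟩, fun h p => ?_⟩
    · simpa [show ¬ ∃ a, e a = p from hp] using h p
    · by_cases hp : p ∈ Set.range e
      · obtain ⟨a, rfl⟩ := hp
        simpa using h.2 a
      · simpa [show ¬ ∃ a, e a = p from hp] using h.1 p hp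
  rw [hsplit]
  refine and_congr_right fun hx => ?_
  have hrows := submatrix_mulVec_eq_of_actsTo (hM.actsTo (ell1Incl κ x)) hx
  rw [coe_ell1Incl] at hrows
  rw [hrows, funext_iff]
  rfl

lemma precondSol_ell2Truncate_eq_zero
    (h : IsUnit (precond (ell2Truncate (Finset.univ.map e) r) C)) (y : Ell2 κ) {p : κ}
    (hp : p ∉ Set.range e) : precondSol (ell2Truncate (Finset.univ.map e) r) C y p = 0 :=
  ((hM.precond_ell2Truncate_eq_iff _ y).1 (precond_precondSol h y)).1 p hp

variable [DecidableEq α]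

lemma isUnit_submatrix (h : IsUnit (precond (ell2Truncate (Finset.univ.map e) r) C)) :
    IsUnit (M.submatrix e e) := by
  refine Matrix.mulVec_injective_iff_isUnit.1 ?_
  refine (injective_iff_map_eq_zero (M.submatrix e e).mulVecLin).2 fun v hv => ?_
  obtain ⟨x, rfl, hx⟩ := exists_ell1_eq_on_range (e := e) v
  have hzero : x = precondSol _ C 0 :=
    eq_precondSol h ((hM.precond_ell2Truncate_eq_iff x 0).2 ⟨hx, hv⟩)
  rw [precondSol, map_zero, map_zero] at hzero
  rw [hzero]
  rfl

lemma precondSol_ell2Truncate_comp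
    (h : IsUnit (precond (ell2Truncate (Finset.univ.map e) r) C)) (y : Ell2 κ) :
    ⇑(precondSol (ell2Truncate (Finset.univ.map e) r) C y) ∘ e =
      (M.submatrix e e)⁻¹ *ᵥ (⇑y ∘ e) := by
  have hdet := (M.submatrix e e).isUnit_iff_isUnit_det.1 (hM.isUnit_submatrix h)
  rw [← ((hM.precond_ell2Truncate_eq_iff _ y).1 (precond_precondSol h y)).2,
    Matrix.mulVec_mulVec, Matrix.nonsing_inv_mul _ hdet, Matrix.one_mulVec]

end IsDiagPerturbation

end FiniteSections

section BlockOperators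

variable {κ α ι : Type}

lemma IsOperatorOf.add {M N : Matrix κ κ ℂ} {L K : Ell2 κ →L[ℂ] Ell2 κ} (hM : IsOperatorOf M L)
    (hN : IsOperatorOf N K) : IsOperatorOf (M + N) (L + K) :=
  fun x => (hM x).add (hN x)

lemma IsOperatorOf.apply_single [DecidableEq κ] {M : Matrix κ κ ℂ} {L : Ell2 κ →L[ℂ] Ell2 κ}
    (hM : IsOperatorOf M L) (p q : κ) : L (lp.single 2 q 1) p = M p q := by
  refine (hM (lp.single 2 q 1) p).unique ?_
  convert hasSum_ite_eq q (M p q) using 2 with q'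
  by_cases h : q' = q <;> simp [h]

lemma isOperatorOf_of_apply_single [DecidableEq κ] {M : Matrix κ κ ℂ} {L : Ell2 κ →L[ℂ] Ell2 κ}
    (h : ∀ p q, L (lp.single 2 q 1) p = M p q) : IsOperatorOf M L := fun x p => by
  have hsum := (ell2_hasSum_single x).mapL (lp.evalCLM ℂ (fun _ : κ => ℂ) 2 p ∘L L)
  refine hsum.congr_fun fun q => ?_
  have hsingle : lp.single (E := fun _ : κ => ℂ) 2 q (x q) = x q • lp.single 2 q 1 := by
    rw [← lp.single_smul, smul_eq_mul, mul_one]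
  rw [hsingle, map_smul, smul_eq_mul, ← h, mul_comm]
  rfl

lemma IsOperatorOf.conjTranspose {M : Matrix κ κ ℂ} {L : Ell2 κ →L[ℂ] Ell2 κ}
    (hM : IsOperatorOf M L) : IsOperatorOf Mᴴ (ContinuousLinearMap.adjoint L) := fun x p => by
  classical
  have hsum := lp.hasSum_inner (𝕜 := ℂ) (L (lp.single 2 p 1)) x
  rw [← ContinuousLinearMap.adjoint_inner_right, lp.inner_single_left] at hsum
  simpa [hM.apply_single, mul_comm] using hsum

lemma IsOperatorOf.submatrix_equiv {M : Matrix κ κ ℂ} {L : Ell2 κ →L[ℂ] Ell2 κ}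
    (hM : IsOperatorOf M L) (σ : α ≃ κ) :
    IsOperatorOf (M.submatrix σ σ)
      (lpRestrict 2 σ.toEmbedding ∘L L ∘L lpRestrict 2 σ.symm.toEmbedding) := fun x a => by
  have hsum := hM (lpRestrict 2 σ.symm.toEmbedding x) (σ a)
  rw [← σ.hasSum_iff] at hsum
  simpa [Function.comp_def] using hsum

lemma hasSum_prod_of_fintype [Fintype ι] {f : ι × κ → ℂ} {a : ι → ℂ}
    (h : ∀ i, HasSum (fun k => f (i, k)) (a i)) : HasSum f (∑ i, a i) := by
  classical
  have hfiber (i : ι) : HasSum (fun p : ι × κ => if p.1 = i then f p else 0) (a i) := by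
    refine ((Prod.mk_right_injective i).hasSum_iff fun p hp => if_neg ?_).1 ?_
    · rintro rfl
      exact hp ⟨p.2, rfl⟩
    · simpa [Function.comp_def] using h i
  simpa using hasSum_sum fun i (_ : i ∈ Finset.univ) => hfiber i

/-- The family of rows of a square-summable family indexed by a product. -/
def ell2Rows (ι κ : Type) : Ell2 (ι × κ) →L[ℂ] ι → Ell2 κ :=
  ContinuousLinearMap.pi fun i => lpRestrict 2 (Function.Embedding.sectR i κ)

lemma ell2Rows_apply (x : Ell2 (ι × κ)) (i : ι) (k : κ) : ell2Rows ι κ x i k = x (i, k) := rfl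

lemma ell2Rows_bijective [Finite ι] : Function.Bijective (ell2Rows ι κ) := by
  refine ⟨fun x y h => ?_, fun y => ?_⟩
  · ext ⟨i, k⟩
    rw [← ell2Rows_apply, h, ell2Rows_apply]
  · have hmem : Memℓp (fun p : ι × κ => y p.1 p.2) 2 := by
      refine memℓp_gen ((summable_prod_of_nonneg fun p => by positivity).2 ⟨fun i => ?_, ?_⟩)
      · exact (lp.memℓp (y i)).summable (by simp)
      · exact .of_finite
    exact ⟨⟨_, hmem⟩, rfl⟩

/-- `ℓ²(ι × κ)` is the direct sum of copies of `ℓ²(κ)`; the inverse is bounded by the open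
mapping theorem. -/
def ell2RowsEquiv (ι κ : Type) [Finite ι] : Ell2 (ι × κ) ≃L[ℂ] (ι → Ell2 κ) :=
  have := Fintype.ofFinite ι
  ContinuousLinearEquiv.ofBijective (ell2Rows ι κ)
    (LinearMap.ker_eq_bot.2 ell2Rows_bijective.1) (LinearMap.range_eq_top.2 ell2Rows_bijective.2)

lemma ell2RowsEquiv_symm_apply [Finite ι] (y : ι → Ell2 κ) (i : ι) (k : κ) :
    (ell2RowsEquiv ι κ).symm y (i, k) = y i k := by
  rw [← ell2Rows_apply]
  exact congrArg (fun z : ι → Ell2 κ => z i k) ((ell2RowsEquiv ι κ).apply_symm_apply y)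

variable [Fintype ι]

/-- The operator on `ℓ²(ι × κ)` with blocks `L i j`. -/
def blockOp [DecidableEq ι] (L : ι → ι → Ell2 κ →L[ℂ] Ell2 κ) :
    Ell2 (ι × κ) →L[ℂ] Ell2 (ι × κ) :=
  ∑ i, ∑ j, ((ell2RowsEquiv ι κ).symm.toContinuousLinearMap ∘L ContinuousLinearMap.single ℂ _ i) ∘L
    L i j ∘L lpRestrict 2 (Function.Embedding.sectR j κ)

lemma blockOp_apply [DecidableEq ι] (L : ι → ι → Ell2 κ →L[ℂ] Ell2 κ) (x : Ell2 (ι × κ))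
    (i : ι) (k : κ) :
    blockOp L x (i, k) = ∑ j, L i j (lpRestrict 2 (Function.Embedding.sectR j κ) x) k := by
  have hplace (i' : ι) (y : Ell2 κ) :
      (ell2RowsEquiv ι κ).symm (Pi.single i' y) (i, k) = if i' = i then y k else 0 := by
    rw [ell2RowsEquiv_symm_apply]
    rcases eq_or_ne i' i with rfl | h
    · simp
    · simp [h, h.symm]
  change lp.evalCLM ℂ (fun _ : ι × κ => ℂ) 2 (i, k) (blockOp L x) = _
  simp only [blockOp, sum_apply, map_sum, ContinuousLinearMap.comp_apply,
    ContinuousLinearEquiv.coe_coe, ContinuousLinearMap.single_apply]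
  simp [lp.evalCLM, hplace]

lemma continuous_blockOp [DecidableEq ι] :
    Continuous (blockOp : (ι → ι → Ell2 κ →L[ℂ] Ell2 κ) → Ell2 (ι × κ) →L[ℂ] Ell2 (ι × κ)) := by
  unfold blockOp
  fun_prop

lemma isOperatorOf_blockOp [DecidableEq ι] {N : ι → ι → Matrix κ κ ℂ}
    {L : ι → ι → Ell2 κ →L[ℂ] Ell2 κ} (h : ∀ i j, IsOperatorOf (N i j) (L i j)) :
    IsOperatorOf (fun p q : ι × κ => N p.1 q.1 p.2 q.2) (blockOp L) := fun x p => by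
  rw [← p.eta, blockOp_apply]
  exact hasSum_prod_of_fintype fun j => h p.1 j (lpRestrict 2 (.sectR j κ) x) p.2

end BlockOperators

section Kronecker

variable {κ : Type} {n : ℕ}

lemma actsTo_one_kronecker_iff {ι : Type} [DecidableEq ι] {M : Matrix κ κ ℂ} {x y : ι × κ → ℂ} :
    ActsTo ((1 : Matrix ι ι ℂ) ⊗ₖ M) x y ↔
      ∀ i, ActsTo M (fun k => x (i, k)) fun k => y (i, k) := by
  rw [ActsTo, Prod.forall]
  refine forall₂_congr fun i k => ?_
  rw [← (Prod.mk_right_injective i).hasSum_iff]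
  · simp [Function.comp_def]
  · rintro ⟨j, l⟩ hj
    have hij : i ≠ j := fun h => hj ⟨l, by rw [h]⟩
    simp [hij]

/-- The exchange of the row and the column index of a vectorised `n × n` family. -/
def swapIndex (n : ℕ) (κ : Type) : Equiv.Perm (Fin n × (Fin n × κ)) :=
  Function.Involutive.toPerm (fun p => (p.2.1, (p.1, p.2.2))) fun _ => rfl

lemma idCirc_eq_submatrix (M : Matrix (Fin n × κ) (Fin n × κ) ℂ) :
    idCirc M = ((1 : Matrix (Fin n) (Fin n) ℂ) ⊗ₖ M).submatrix (swapIndex n κ) (swapIndex n κ) :=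
  rfl

lemma actsTo_idCirc_iff {M : Matrix (Fin n × κ) (Fin n × κ) ℂ}
    {x y : Fin n × (Fin n × κ) → ℂ} :
    ActsTo (idCirc M) x y ↔
      ∀ i, ActsTo M (fun p => x (p.1, (i, p.2))) fun p => y (p.1, (i, p.2)) := by
  have hswap : ActsTo (idCirc M) x y ↔ ActsTo ((1 : Matrix (Fin n) (Fin n) ℂ) ⊗ₖ M)
      (x ∘ swapIndex n κ) (y ∘ swapIndex n κ) := by
    rw [ActsTo, ← (swapIndex n κ).forall_congr_right]
    exact forall_congr' fun p => ((swapIndex n κ).hasSum_iff).symm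
  exact hswap.trans actsTo_one_kronecker_iff

lemma exists_isOperatorOf_one_kronecker {ι : Type} [Finite ι] [DecidableEq ι]
    {M : Matrix κ κ ℂ} {L : Ell2 κ →L[ℂ] Ell2 κ} (hM : IsOperatorOf M L) :
    ∃ K, IsOperatorOf ((1 : Matrix ι ι ℂ) ⊗ₖ M) K := by
  refine ⟨(ell2RowsEquiv ι κ).symm ∘L (ContinuousLinearMap.pi fun i =>
    L ∘L ContinuousLinearMap.proj i) ∘L ell2Rows ι κ, fun x => actsTo_one_kronecker_iff.2 ?_⟩
  intro i
  simpa only [ContinuousLinearMap.comp_apply, ContinuousLinearEquiv.coe_coe,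
    ell2RowsEquiv_symm_apply] using! hM (ell2Rows ι κ x i)

lemma exists_isOperatorOf_idCirc {M : Matrix (Fin n × κ) (Fin n × κ) ℂ}
    {L : Ell2 (Fin n × κ) →L[ℂ] Ell2 (Fin n × κ)} (hM : IsOperatorOf M L) :
    ∃ K, IsOperatorOf (idCirc M) K := by
  obtain ⟨K, hK⟩ := exists_isOperatorOf_one_kronecker (ι := Fin n) hM
  exact ⟨_, idCirc_eq_submatrix M ▸ hK.submatrix_equiv (swapIndex n κ)⟩

end Kronecker

section Laurent

open AddCircle

variable {T : ℝ} [hT : Fact (0 < T)]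

/-- Multiplication by a bounded function, as an operator on the Fourier coefficients. -/
def laurentOp : Lp ℂ ∞ (haarAddCircle (T := T)) →L[ℂ] Ell2 ℤ →L[ℂ] Ell2 ℤ :=
  ((fourierBasis (T := T)).repr.toContinuousLinearEquiv.arrowCongr
    (fourierBasis (T := T)).repr.toContinuousLinearEquiv).toContinuousLinearMap ∘L
    (ContinuousLinearMap.mul ℂ ℂ).holderL haarAddCircle ∞ 2 2

lemma laurentOp_apply (f : Lp ℂ ∞ (haarAddCircle (T := T))) (x : Ell2 ℤ) :
    laurentOp f x = fourierBasis.repr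
      ((ContinuousLinearMap.mul ℂ ℂ).holder 2 f (fourierBasis.repr.symm x)) :=
  rfl

lemma laurentOp_single (f : Lp ℂ ∞ (haarAddCircle (T := T))) (k l : ℤ) :
    laurentOp f (lp.single 2 l 1) k = fourierCoeff f (k - l) := by
  rw [laurentOp_apply, fourierBasis_repr, HilbertBasis.repr_symm_single, coe_fourierBasis]
  refine integral_congr_ae ?_
  filter_upwards [(ContinuousLinearMap.mul ℂ ℂ).coeFn_holder (r := 2) f (fourierLp 2 l),
    coeFn_fourierLp (T := T) 2 l] with t hmul hfourier
  rw [hmul, hfourier, ContinuousLinearMap.mul_apply', smul_eq_mul, smul_eq_mul, neg_sub,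
    sub_eq_add_neg, fourier_add]
  ring

lemma isOperatorOf_laurentOp {f : AddCircle T → ℂ} (hf : MemLp f ∞ haarAddCircle) :
    IsOperatorOf (fun k l => fourierCoeff f (k - l)) (laurentOp (hf.toLp f)) :=
  isOperatorOf_of_apply_single fun k l => by
    rw [laurentOp_single, fourierCoeff_congr_ae hf.coeFn_toLp]

lemma fourierCoeff_eq_fourierBasis_repr {f : AddCircle T → ℂ} (hf : MemLp f 2 haarAddCircle) :
    fourierCoeff f = fourierBasis.repr (hf.toLp f) := by
  ext k
  rw [fourierBasis_repr, fourierCoeff_congr_ae hf.coeFn_toLp]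

lemma memℓp_fourierCoeff {f : AddCircle T → ℂ} (hf : MemLp f 2 haarAddCircle) :
    Memℓp (fourierCoeff f) 2 := by
  rw [fourierCoeff_eq_fourierBasis_repr hf]
  exact lp.memℓp _

lemma ae_eq_of_fourierCoeff_eq {f g : AddCircle T → ℂ} (hf : MemLp f 2 haarAddCircle)
    (hg : MemLp g 2 haarAddCircle) (h : fourierCoeff f = fourierCoeff g) :
    f =ᵐ[haarAddCircle] g := by
  rw [fourierCoeff_eq_fourierBasis_repr hf, fourierCoeff_eq_fourierBasis_repr hg] at h
  exact (MemLp.toLp_eq_toLp_iff hf hg).1 (fourierBasis.repr.injective (lp.ext h))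

lemma star_fourierCoeff_ofReal (f : AddCircle T → ℝ) (k : ℤ) :
    star (fourierCoeff (fun t => (f t : ℂ)) k) = fourierCoeff (fun t => (f t : ℂ)) (-k) := by
  simp only [fourierCoeff, RCLike.star_def, ← integral_conj]
  congr with t
  simp

/-- The continuous function with given absolutely summable Fourier coefficients. -/
def synth : Ell1 ℤ →L[ℂ] C(AddCircle T, ℂ) :=
  lp.tsumCLM ℂ ℤ C(AddCircle T, ℂ) ∘L
    lp.mapCLM 1 (fun k => ContinuousLinearMap.toSpanSingleton ℂ (fourier (T := T) k))
      zero_le_one (by simp [fourier_norm])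

lemma hasSum_synth (x : Ell1 ℤ) : HasSum (fun k => x k • fourier (T := T) k) (synth x) := by
  refine Summable.hasSum (Summable.of_norm ?_)
  simpa [norm_smul, fourier_norm] using (lp.memℓp x).summable (by simp)

lemma fourierCoeff_eq_of_hasSum {c : ℤ → ℂ} {g : C(AddCircle T, ℂ)}
    (hg : HasSum (fun k => c k • fourier k) g) : fourierCoeff g = c := by
  ext k
  let coeff : C(AddCircle T, ℂ) →L[ℂ] ℂ := lp.evalCLM ℂ (fun _ : ℤ => ℂ) 2 k ∘L
    (fourierBasis (T := T)).repr.toContinuousLinearEquiv.toContinuousLinearMap ∘L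
      ContinuousMap.toLp 2 haarAddCircle ℂ
  have hcoeff (f : C(AddCircle T, ℂ)) : coeff f = fourierCoeff f k := by
    rw [← fourierCoeff_toLp, ← fourierBasis_repr]
    rfl
  rw [← hcoeff]
  refine (hg.mapL coeff).unique ?_
  convert hasSum_ite_eq k (c k) using 2 with l
  rw [map_smul, hcoeff, fourierCoeff_fourier]
  rcases eq_or_ne l k with rfl | h
  · simp
  · simp [h, h.symm]

lemma memLp_top_continuousMap (g : C(AddCircle T, ℂ)) : MemLp g ∞ haarAddCircle :=
  memLp_top_of_bound g.continuous.aestronglyMeasurable ‖g‖ (.of_forall g.norm_coe_le_norm)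

end Laurent

section Phasors

open AddCircle

variable {T : ℝ} [hT : Fact (0 < T)] {n : ℕ} {P : AddCircle T → Matrix (Fin n) (Fin n) ℂ}

/-- The square-summable vector `col(𝐏)` of the phasors of a bounded matrix function. -/
def colVec (hP : IsLInfty P) : Ell2 (Fin n × (Fin n × ℤ)) :=
  (ell2RowsEquiv _ _).symm fun j => (ell2RowsEquiv _ _).symm fun i =>
    ⟨fourierCoeff fun t => P t i j, memℓp_fourierCoeff ((hP i j).mono_exponent le_top)⟩

lemma colVec_apply (hP : IsLInfty P) (p : Fin n × (Fin n × ℤ)) :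
    colVec hP p = colPhasor P p := by
  rw [← p.eta, ← p.2.eta, colVec, ell2RowsEquiv_symm_apply, ell2RowsEquiv_symm_apply]
  rfl

lemma coe_colVec (hP : IsLInfty P) : (colVec hP : Fin n × (Fin n × ℤ) → ℂ) = colPhasor P :=
  funext (colVec_apply hP)

lemma ae_eq_of_colPhasor_eq {P' : AddCircle T → Matrix (Fin n) (Fin n) ℂ} (hP : IsLInfty P)
    (hP' : IsLInfty P') (h : colPhasor P = colPhasor P') : P =ᵐ[haarAddCircle] P' := by
  have hentry (i j : Fin n) : (fun t => P t i j) =ᵐ[haarAddCircle] fun t => P' t i j :=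
    ae_eq_of_fourierCoeff_eq ((hP i j).mono_exponent le_top) ((hP' i j).mono_exponent le_top)
      (funext fun k => congrFun h (j, (i, k)))
  filter_upwards [ae_all_iff.2 fun i => ae_all_iff.2 (hentry i)] with t ht
  exact Matrix.ext ht

/-- The bounded operator with matrix `𝒯(P)`. -/
def toeplitzOp (hP : IsLInfty P) : Ell2 (Fin n × ℤ) →L[ℂ] Ell2 (Fin n × ℤ) :=
  blockOp fun i j => laurentOp ((hP i j).toLp fun t => P t i j)

lemma isOperatorOf_toeplitzOp (hP : IsLInfty P) : IsOperatorOf (toeplitz P) (toeplitzOp hP) :=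
  isOperatorOf_blockOp (N := fun i j k l => phasor P i j (k - l))
    (L := fun i j => laurentOp ((hP i j).toLp fun t => P t i j))
    fun i j => isOperatorOf_laurentOp (hP i j)

/-- The positions in `col(𝐏)` of the phasors of the entry `(i, j)`. -/
def entryIndex (i j : Fin n) : ℤ ↪ Fin n × (Fin n × ℤ) :=
  (Function.Embedding.sectR i ℤ).trans (Function.Embedding.sectR j (Fin n × ℤ))

/-- The continuous matrix function whose vectorised phasors are a given absolutely summable
family. -/
def synthMat (x : Ell1 (Fin n × (Fin n × ℤ))) : AddCircle T → Matrix (Fin n) (Fin n) ℂ :=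
  fun t => Matrix.of fun i j => synth (lpRestrict 1 (entryIndex i j) x) t

lemma isLInfty_synthMat (x : Ell1 (Fin n × (Fin n × ℤ))) : IsLInfty (synthMat (T := T) x) :=
  fun i j => memLp_top_continuousMap (synth (lpRestrict 1 (entryIndex i j) x))

lemma colPhasor_synthMat (x : Ell1 (Fin n × (Fin n × ℤ))) :
    colPhasor (synthMat (T := T) x) = x :=
  funext fun p => congrFun
    (fourierCoeff_eq_of_hasSum (hasSum_synth (lpRestrict 1 (entryIndex p.2.1 p.1) x))) p.2.2

lemma continuous_toeplitzOp_synthMat :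
    Continuous fun x : Ell1 (Fin n × (Fin n × ℤ)) => toeplitzOp (isLInfty_synthMat (T := T) x) := by
  have htoLp (x : Ell1 (Fin n × (Fin n × ℤ))) (i j : Fin n) :
      (isLInfty_synthMat (T := T) x i j).toLp (fun t => synthMat x t i j) =
        ContinuousMap.toLp ∞ haarAddCircle ℂ (synth (lpRestrict 1 (entryIndex i j) x)) :=
    rfl
  unfold toeplitzOp
  simp only [htoLp]
  exact continuous_blockOp.comp (by fun_prop)

end Phasors

section LyapunovMatrix

variable {T : ℝ} {n : ℕ}

/-- The angular frequency `i ω k`, a diagonal entry of `𝒩`. -/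
def freq (T : ℝ) (k : ℤ) : ℂ := Complex.I * ((2 * Real.pi / T : ℝ) : ℂ) * (k : ℂ)

lemma star_freq (k : ℤ) : star (freq T k) = -freq T k := by
  simp [freq]

lemma freq_sub (k l : ℤ) : freq T (k - l) = freq T k - freq T l := by
  simp [freq, mul_sub]

lemma nMat_eq_diagonal : nMat T n = Matrix.diagonal fun p => freq T p.2 := by
  rw [nMat, ← Matrix.diagonal_one, Matrix.diagonal_kronecker_diagonal]
  simp only [one_mul, freq]

lemma conjTranspose_nMat : (nMat T n)ᴴ = -nMat T n := by
  rw [nMat_eq_diagonal, Matrix.diagonal_conjTranspose, Matrix.diagonal_neg]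
  exact congrArg _ (funext fun p => star_freq p.2)

lemma conjTranspose_sub_nMat (𝒜 : Matrix (Fin n × ℤ) (Fin n × ℤ) ℂ) :
    (𝒜 - nMat T n)ᴴ = 𝒜ᴴ + nMat T n := by
  rw [Matrix.conjTranspose_sub, conjTranspose_nMat, sub_neg_eq_add]

lemma lyapMat_nMat (𝒜 : Matrix (Fin n × ℤ) (Fin n × ℤ) ℂ) :
    lyapMat 𝒜 (nMat T n) = (1 : Matrix (Fin n) (Fin n) ℂ) ⊗ₖ 𝒜ᴴ + idCirc 𝒜ᴴ +
      Matrix.diagonal fun p => freq T p.2.2 := by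
  have hdiag : (1 : Matrix (Fin n) (Fin n) ℂ) ⊗ₖ nMat T n =
      Matrix.diagonal fun p => freq T p.2.2 := by
    rw [nMat_eq_diagonal, ← Matrix.diagonal_one, Matrix.diagonal_kronecker_diagonal]
    simp only [one_mul]
  rw [lyapMat, conjTranspose_sub_nMat, Matrix.kronecker_add, hdiag, add_right_comm]

lemma isDiagPerturbation_add_diagonal {κ : Type} [DecidableEq κ] {M : Matrix κ κ ℂ}
    {K : Ell2 κ →L[ℂ] Ell2 κ} (hM : IsOperatorOf M K) {d : κ → ℂ} {r : Ell2 κ}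
    (hd : ∀ p, 1 + d p ≠ 0) (hr : ∀ p, r p = (1 + d p)⁻¹) :
    IsDiagPerturbation (M + Matrix.diagonal d) r (K - 1) where
  ne_zero p := by
    rw [hr]
    exact inv_ne_zero (hd p)
  actsTo x p := by
    have hval : (r p)⁻¹ * x p + (K x p - x p) = K x p + d p * x p := by
      rw [hr, inv_inv]
      ring
    change HasSum _ ((r p)⁻¹ * x p + (K x p - x p))
    rw [hval]
    exact (hM x).add (actsTo_diagonal d x) p

lemma one_add_freq_ne_zero (k : ℤ) : 1 + freq T k ≠ 0 := fun h => by
  simpa [freq] using congrArg Complex.re h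

lemma norm_one_add_freq_sq (k : ℤ) :
    ‖1 + freq T k‖ ^ 2 = 1 + (2 * Real.pi / T) ^ 2 * (k : ℝ) ^ 2 := by
  rw [← Complex.normSq_eq_norm_sq, Complex.normSq_apply]
  simp [freq]
  ring

variable [hT : Fact (0 < T)]

lemma memℓp_inv_one_add_freq : Memℓp (fun k : ℤ => (1 + freq T k)⁻¹) 2 := by
  have hT₀ : 0 < T := hT.out
  have hsum := (Real.summable_one_div_int_pow (p := 2)).2 one_lt_two
  refine memℓp_gen (.of_norm_bounded_eventually (hsum.mul_left ((2 * Real.pi / T) ^ 2)⁻¹) ?_)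
  filter_upwards [(Set.finite_singleton (0 : ℤ)).compl_mem_cofinite] with k hk
  have hk₀ : (k : ℝ) ≠ 0 := by exact_mod_cast hk
  rw [ENNReal.toReal_ofNat, Real.rpow_two, norm_pow, norm_norm, norm_inv, inv_pow,
    norm_one_add_freq_sq, one_div, ← mul_inv]
  exact inv_anti₀ (by positivity) (by linarith)

/-- The diagonal of `(1 + 𝒩)⁻¹`, repeated on the columns of the vectorised phasors. -/
def resolventDiag (T : ℝ) [Fact (0 < T)] (n : ℕ) : Ell2 (Fin n × (Fin n × ℤ)) :=
  (ell2RowsEquiv _ _).symm fun _ => (ell2RowsEquiv _ _).symm fun _ =>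
    ⟨_, memℓp_inv_one_add_freq (T := T)⟩

lemma resolventDiag_apply (p : Fin n × (Fin n × ℤ)) :
    resolventDiag T n p = (1 + freq T p.2.2)⁻¹ := by
  rw [← p.eta, ← p.2.eta, resolventDiag, ell2RowsEquiv_symm_apply, ell2RowsEquiv_symm_apply]

lemma exists_isDiagPerturbation_lyapMat {𝒜 : Matrix (Fin n × ℤ) (Fin n × ℤ) ℂ}
    {L : Ell2 (Fin n × ℤ) →L[ℂ] Ell2 (Fin n × ℤ)} (h𝒜 : IsOperatorOf 𝒜 L) :
    ∃ C, IsDiagPerturbation (lyapMat 𝒜 (nMat T n)) (resolventDiag T n) C := by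
  obtain ⟨K₁, hK₁⟩ := exists_isOperatorOf_one_kronecker (ι := Fin n) h𝒜.conjTranspose
  obtain ⟨K₂, hK₂⟩ := exists_isOperatorOf_idCirc h𝒜.conjTranspose
  rw [lyapMat_nMat]
  exact ⟨_, isDiagPerturbation_add_diagonal (hK₁.add hK₂) (fun p => one_add_freq_ne_zero p.2.2)
    resolventDiag_apply⟩

end LyapunovMatrix

section LyapunovEquation

open AddCircle

variable {T : ℝ} [hT : Fact (0 < T)] {n : ℕ} {x y : Fin n × (Fin n × ℤ) → ℂ}

/-- The block Toeplitz matrix with vectorised phasors `x`, so that `𝒯(P)` is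
`blockToeplitz (colPhasor P)`. -/
def blockToeplitz (x : Fin n × (Fin n × ℤ) → ℂ) : Matrix (Fin n × ℤ) (Fin n × ℤ) ℂ :=
  fun p q => x (q.1, (p.1, p.2 - q.2))

lemma blockToeplitz_injective :
    Function.Injective (blockToeplitz : (Fin n × (Fin n × ℤ) → ℂ) → _) := fun x y h => by
  ext ⟨j, i, k⟩
  simpa [blockToeplitz] using congrFun (congrFun h (i, k)) (j, 0)

lemma isProd_conjTranspose_toeplitz_blockToeplitz {A : AddCircle T → Matrix (Fin n) (Fin n) ℂ}
    (h : ActsTo ((1 : Matrix (Fin n) (Fin n) ℂ) ⊗ₖ (toeplitz A)ᴴ) x y) :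
    IsProd (toeplitz A)ᴴ (blockToeplitz x) (blockToeplitz y) := fun p q => by
  have hsum := actsTo_one_kronecker_iff.1 h q.1 (p.1, p.2 - q.2)
  rw [← ((Equiv.refl (Fin n)).prodCongr (Equiv.subRight q.2)).hasSum_iff] at hsum
  refine hsum.congr_fun fun r => ?_
  simp [toeplitz, blockToeplitz, Prod.map]

lemma star_phasor_toC (A : AddCircle T → Matrix (Fin n) (Fin n) ℝ) (i j : Fin n) (k : ℤ) :
    star (phasor (toC A) i j k) = phasor (toC A) i j (-k) :=
  star_fourierCoeff_ofReal (fun t => A t i j) k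

lemma isProd_blockToeplitz_toeplitz {A : AddCircle T → Matrix (Fin n) (Fin n) ℝ}
    (h : ActsTo (idCirc (toeplitz (toC A))ᴴ) x y) :
    IsProd (blockToeplitz x) (toeplitz (toC A)) (blockToeplitz y) := fun p q => by
  have hsum := actsTo_idCirc_iff.1 h p.1 (q.1, p.2 - q.2)
  rw [← ((Equiv.refl (Fin n)).prodCongr (Equiv.subLeft p.2)).hasSum_iff] at hsum
  refine hsum.congr_fun fun r => ?_
  simp [toeplitz, blockToeplitz, star_phasor_toC, Prod.map, mul_comm]

variable {A : AddCircle T → Matrix (Fin n) (Fin n) ℝ} {P Q : AddCircle T → Matrix (Fin n) (Fin n) ℂ}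

lemma exists_isProd_iff_eq {y₁ y₂ : Fin n × (Fin n × ℤ) → ℂ} (z : Fin n × (Fin n × ℤ) → ℂ)
    (h₁ : ActsTo ((1 : Matrix (Fin n) (Fin n) ℂ) ⊗ₖ (toeplitz (toC A))ᴴ) x y₁)
    (h₂ : ActsTo (idCirc (toeplitz (toC A))ᴴ) x y₂) :
    (∃ U V : Matrix (Fin n × ℤ) (Fin n × ℤ) ℂ,
      IsProd (blockToeplitz x) (toeplitz (toC A) - nMat T n) U ∧
      IsProd (toeplitz (toC A) - nMat T n)ᴴ (blockToeplitz x) V ∧ U + V + blockToeplitz z = 0) ↔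
    y₁ + y₂ + (fun p => freq T p.2.2) * x = -z := by
  have hU := (isProd_blockToeplitz_toeplitz h₂).sub_right
    (isProd_diagonal_right (fun p => freq T p.2) (blockToeplitz x))
  have hV := (isProd_conjTranspose_toeplitz_blockToeplitz h₁).add_left
    (isProd_diagonal_left (fun p => freq T p.2) (blockToeplitz x))
  rw [← nMat_eq_diagonal] at hU hV
  rw [← conjTranspose_sub_nMat] at hV
  have hsum : (blockToeplitz y₂ - Matrix.of fun p q => blockToeplitz x p q * freq T q.2) +
      (blockToeplitz y₁ + Matrix.of fun p q => freq T p.2 * blockToeplitz x p q) =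
      blockToeplitz (y₁ + y₂ + (fun p => freq T p.2.2) * x) := by
    ext p q
    simp only [Matrix.add_apply, Matrix.sub_apply, Matrix.of_apply, blockToeplitz, Pi.add_apply,
      Pi.mul_apply, freq_sub]
    ring
  rw [← blockToeplitz_injective.eq_iff, ← hsum]
  change _ ↔ _ = -blockToeplitz z
  rw [← add_eq_zero_iff_eq_neg]
  refine ⟨fun ⟨U, V, hU', hV', h⟩ => ?_, fun h => ⟨_, _, hU, hV, h⟩⟩
  rwa [hU.eq hU', hV.eq hV']

lemma toeplitz_eq_blockToeplitz (P : AddCircle T → Matrix (Fin n) (Fin n) ℂ) :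
    toeplitz P = blockToeplitz (colPhasor P) := rfl

lemma isLyapSol_iff (hA : IsLInfty (toC A)) :
    IsLyapSol A Q P ↔ IsLInfty P ∧
      ActsTo (lyapMat (toeplitz (toC A)) (nMat T n)) (colPhasor P) (-colPhasor Q) := by
  refine and_congr_right fun hP => ?_
  have h𝒜 := (isOperatorOf_toeplitzOp hA).conjTranspose
  obtain ⟨y₁, h₁⟩ : ∃ y, ActsTo ((1 : Matrix (Fin n) (Fin n) ℂ) ⊗ₖ (toeplitz (toC A))ᴴ)
      (colPhasor P) y := by
    obtain ⟨K, hK⟩ := exists_isOperatorOf_one_kronecker (ι := Fin n) h𝒜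
    rw [← coe_colVec hP]
    exact ⟨_, hK (colVec hP)⟩
  obtain ⟨y₂, h₂⟩ : ∃ y, ActsTo (idCirc (toeplitz (toC A))ᴴ) (colPhasor P) y := by
    obtain ⟨K, hK⟩ := exists_isOperatorOf_idCirc h𝒜
    rw [← coe_colVec hP]
    exact ⟨_, hK (colVec hP)⟩
  have hfreq := actsTo_diagonal (fun p : Fin n × (Fin n × ℤ) => freq T p.2.2) (colPhasor P)
  rw [lyapMat_nMat, ((h₁.add h₂).add hfreq).actsTo_iff_eq,
    ← exists_isProd_iff_eq (colPhasor Q) h₁ h₂, toeplitz_eq_blockToeplitz P,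
    toeplitz_eq_blockToeplitz Q]

end LyapunovEquation

section HarmonicTruncation

variable {n : ℕ}

/-- The inclusion of the harmonics `|k| ≤ m` kept by the `m`-truncation into all harmonics, in the
indexing of vectorised phasors. -/
def truncIndex (n m : ℕ) : Fin n × (Fin n × Idx m) ↪ Fin n × (Fin n × ℤ) :=
  (Function.Embedding.refl _).prodMap
    ((Function.Embedding.refl _).prodMap (Function.Embedding.subtype _))

lemma mem_range_truncIndex {m : ℕ} {p : Fin n × (Fin n × ℤ)} :
    p ∈ Set.range (truncIndex n m) ↔ p.2.2 ∈ Finset.Icc (-(m : ℤ)) m :=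
  ⟨fun ⟨q, hq⟩ => hq ▸ q.2.2.2, fun h => ⟨(p.1, (p.2.1, ⟨p.2.2, h⟩)), rfl⟩⟩

lemma tendsto_map_truncIndex :
    Tendsto (fun m => Finset.univ.map (truncIndex n m)) atTop atTop := by
  have hmem (m : ℕ) (p : Fin n × (Fin n × ℤ)) :
      p ∈ Finset.univ.map (truncIndex n m) ↔ -(m : ℤ) ≤ p.2.2 ∧ p.2.2 ≤ m := by
    rw [← Finset.mem_coe, Finset.coe_map, Finset.coe_univ, Set.image_univ, mem_range_truncIndex,
      Finset.mem_Icc]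
  refine tendsto_atTop_finset_of_monotone (fun m m' h p => ?_) fun p => ⟨p.2.2.natAbs, ?_⟩
  · rw [hmem, hmem]
    omega
  · rw [hmem]
    omega

variable {T : ℝ} [hT : Fact (0 < T)] {A : AddCircle T → Matrix (Fin n) (Fin n) ℝ}
  {Q : AddCircle T → Matrix (Fin n) (Fin n) ℂ} {m : ℕ}

lemma truncLyapMat_eq_submatrix (A : AddCircle T → Matrix (Fin n) (Fin n) ℝ) (m : ℕ) :
    truncLyapMat A m = (lyapMat (toeplitz (toC A)) (nMat T n)).submatrix
      (truncIndex n m) (truncIndex n m) := rfl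

lemma truncFun_eq_synthMat {x : Ell1 (Fin n × (Fin n × ℤ))} (hx : ⇑x = truncPhasor A Q m) :
    truncFun A Q m = synthMat x := by
  ext t i j
  have hsum := (ContinuousMap.evalCLM ℂ t).hasSum
    (hasSum_synth (T := T) (lpRestrict 1 (entryIndex i j) x))
  have hx' (k : ℤ) : x (entryIndex i j k) = truncPhasor A Q m (j, (i, k)) := by rw [hx]; rfl
  rw [truncFun, synthMat, Matrix.of_apply, Matrix.of_apply]
  refine (hasSum_sum_of_ne_finset_zero fun k hk => ?_).unique (hsum.congr_fun fun k => ?_)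
  · rw [truncPhasor, dif_neg hk, zero_mul]
  · simp [hx', lpRestrict_apply]

variable {r : Ell2 (Fin n × (Fin n × ℤ))}
  {C : Ell2 (Fin n × (Fin n × ℤ)) →L[ℂ] Ell2 (Fin n × (Fin n × ℤ))}

lemma precondSol_ell2Truncate_eq_truncPhasor
    (hM : IsDiagPerturbation (lyapMat (toeplitz (toC A)) (nMat T n)) r C)
    (h : IsUnit (precond (ell2Truncate (Finset.univ.map (truncIndex n m)) r) C))
    (hQ : IsLInfty Q) :
    ⇑(precondSol (ell2Truncate (Finset.univ.map (truncIndex n m)) r) C (-colVec hQ)) =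
      truncPhasor A Q m := by
  ext p
  by_cases hp : p ∈ Set.range (truncIndex n m)
  · obtain ⟨q, rfl⟩ := hp
    have hq := congrFun (hM.precondSol_ell2Truncate_comp h (-colVec hQ)) q
    rw [← truncLyapMat_eq_submatrix, lp.coeFn_neg, coe_colVec] at hq
    refine hq.trans ?_
    rw [truncPhasor, dif_pos (mem_range_truncIndex.1 ⟨q, rfl⟩)]
    exact congrFun (Matrix.mulVec_neg (colPhasor Q ∘ truncIndex n m) (truncLyapMat A m)⁻¹) q
  · rw [hM.precondSol_ell2Truncate_eq_zero h _ hp, truncPhasor,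
      dif_neg (mem_range_truncIndex.not.1 hp)]

lemma exists_tendsto_and_eventually_eq_truncPhasor
    (hM : IsDiagPerturbation (lyapMat (toeplitz (toC A)) (nMat T n)) r C)
    (h : IsUnit (precond r C)) (hQ : IsLInfty Q) :
    ∃ x : ℕ → Ell1 (Fin n × (Fin n × ℤ)),
      Tendsto x atTop (𝓝 (precondSol r C (-colVec hQ))) ∧
      ∀ᶠ m in atTop, IsUnit (truncLyapMat A m) ∧ ⇑(x m) = truncPhasor A Q m := by
  refine ⟨_, (tendsto_precondSol_ell2Truncate h _).comp tendsto_map_truncIndex, ?_⟩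
  filter_upwards [tendsto_map_truncIndex.eventually (eventually_isUnit_precond_ell2Truncate h)]
    with m hm
  exact ⟨hM.isUnit_submatrix hm, precondSol_ell2Truncate_eq_truncPhasor hM hm hQ⟩

end HarmonicTruncation

section Solution

variable {T : ℝ} [hT : Fact (0 < T)] {n : ℕ} {A : AddCircle T → Matrix (Fin n) (Fin n) ℝ}
  {Q P P' : AddCircle T → Matrix (Fin n) (Fin n) ℂ}

lemma IsLyapSol.ae_eq (hA : IsLInfty (toC A)) (hQ : IsLInfty Q)
    (hM : IsInvertibleOp (lyapMat (toeplitz (toC A)) (nMat T n)))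
    (hP : IsLyapSol A Q P) (hP' : IsLyapSol A Q P') : P =ᵐ[AddCircle.haarAddCircle] P' := by
  obtain ⟨R, -, hR⟩ := hM
  obtain ⟨hP, hsol⟩ := (isLyapSol_iff hA).1 hP
  obtain ⟨hP', hsol'⟩ := (isLyapSol_iff hA).1 hP'
  rw [← coe_colVec hP, ← coe_colVec hQ, ← lp.coeFn_neg] at hsol
  rw [← coe_colVec hP', ← coe_colVec hQ, ← lp.coeFn_neg] at hsol'
  refine ae_eq_of_colPhasor_eq hP hP' ?_
  rw [← coe_colVec hP, ← coe_colVec hP', ← hR _ _ hsol, ← hR _ _ hsol']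

lemma colPhasor_zero : colPhasor (fun _ : AddCircle T => (0 : Matrix (Fin n) (Fin n) ℂ)) = 0 := by
  ext p
  simp [colPhasor, phasor, fourierCoeff]

lemma colPhasor_congr_ae (h : P =ᵐ[AddCircle.haarAddCircle] P') : colPhasor P = colPhasor P' :=
  funext fun p => congrFun (fourierCoeff_congr_ae (h.fun_comp (· p.2.1 p.1))) p.2.2

lemma eq_zero_of_actsTo_lyapMat_zero (hA : IsLInfty (toC A))
    (huniq : ∀ P₀ : AddCircle T → Matrix (Fin n) (Fin n) ℂ,
      IsLyapSol A (fun _ => 0) P₀ → P₀ =ᵐ[AddCircle.haarAddCircle] fun _ => 0)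
    (x : Ell1 (Fin n × (Fin n × ℤ)))
    (hx : ActsTo (lyapMat (toeplitz (toC A)) (nMat T n)) x 0) : x = 0 := by
  have hsol : IsLyapSol A (fun _ => 0) (synthMat (T := T) x) := by
    refine (isLyapSol_iff hA).2 ⟨isLInfty_synthMat x, ?_⟩
    rwa [colPhasor_synthMat, colPhasor_zero, neg_zero]
  ext p
  rw [← colPhasor_synthMat (T := T) x, colPhasor_congr_ae (huniq _ hsol), colPhasor_zero]
  rfl

lemma isLyapSol_synthMat_precondSol {r : Ell2 (Fin n × (Fin n × ℤ))}
    {C : Ell2 (Fin n × (Fin n × ℤ)) →L[ℂ] Ell2 (Fin n × (Fin n × ℤ))}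
    (hM : IsDiagPerturbation (lyapMat (toeplitz (toC A)) (nMat T n)) r C)
    (h : IsUnit (precond r C)) (hA : IsLInfty (toC A)) (hQ : IsLInfty Q) :
    IsLyapSol A Q (synthMat (precondSol r C (-colVec hQ))) := by
  refine (isLyapSol_iff hA).2 ⟨isLInfty_synthMat _, ?_⟩
  rw [colPhasor_synthMat, ← coe_colVec hQ, ← lp.coeFn_neg]
  exact hM.actsTo_precondSol h _

end Solution

end

end Harmonic

open Harmonic Filter Topology in
theorem mainTheorem2 {T : ℝ} [hT : Fact (0 < T)] {n : ℕ}
    (A : AddCircle T → Matrix (Fin n) (Fin n) ℝ)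
    (Q : AddCircle T → Matrix (Fin n) (Fin n) ℂ)
    (hA : Harmonic.IsLInfty (Harmonic.toC A)) (hQ : Harmonic.IsLInfty Q)
    (hinv : Harmonic.IsInvertibleOp (Harmonic.toeplitz (Harmonic.toC A) - Harmonic.nMat T n))
    (huniq : ∀ P₀ : AddCircle T → Matrix (Fin n) (Fin n) ℂ,
      Harmonic.IsLyapSol A (fun _ => 0) P₀ → P₀ =ᵐ[AddCircle.haarAddCircle] fun _ => 0) :
    ∃ P : AddCircle T → Matrix (Fin n) (Fin n) ℂ,
      Harmonic.IsLyapSol A Q P ∧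
      (∀ P' : AddCircle T → Matrix (Fin n) (Fin n) ℂ,
        Harmonic.IsLyapSol A Q P' → P' =ᵐ[AddCircle.haarAddCircle] P) ∧
      Harmonic.IsInvertibleOp
        (Harmonic.lyapMat (Harmonic.toeplitz (Harmonic.toC A)) (Harmonic.nMat T n)) ∧
      Harmonic.ActsTo
        (Harmonic.lyapMat (Harmonic.toeplitz (Harmonic.toC A)) (Harmonic.nMat T n))
        (Harmonic.colPhasor P) (-Harmonic.colPhasor Q) ∧
      ∀ ε : ℝ, 0 < ε → ∃ m₀ : ℕ, ∀ m : ℕ, m₀ ≤ m →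
        IsUnit (Harmonic.truncLyapMat A m) ∧
        (∃ d : Harmonic.Ell2 (Fin n × (Fin n × ℤ)),
          (∀ p, d p = Harmonic.colPhasor P p - Harmonic.truncPhasor A Q m p) ∧ ‖d‖ < ε) ∧
        ∃ L L' : Harmonic.Ell2 (Fin n × ℤ) →L[ℂ] Harmonic.Ell2 (Fin n × ℤ),
          Harmonic.IsOperatorOf (Harmonic.toeplitz P) L ∧
          Harmonic.IsOperatorOf (Harmonic.toeplitz (Harmonic.truncFun A Q m)) L' ∧
          ‖L - L'‖ < ε := by
  obtain ⟨C, hM⟩ := exists_isDiagPerturbation_lyapMat (T := T) (isOperatorOf_toeplitzOp hA)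
  have hunit := hM.isUnit_precond (eq_zero_of_actsTo_lyapMat_zero hA huniq)
  have hsol := isLyapSol_synthMat_precondSol hM hunit hA hQ
  refine ⟨_, hsol, fun P' hP' => hP'.ae_eq hA hQ (hM.isInvertibleOp hunit) hsol,
    hM.isInvertibleOp hunit, ((isLyapSol_iff hA).1 hsol).2, fun ε hε => ?_⟩
  obtain ⟨y, hlim, htrunc⟩ := exists_tendsto_and_eventually_eq_truncPhasor hM hunit hQ
  have hcol := Metric.tendsto_nhds.1 (((ell1Incl _).continuous.tendsto _).comp hlim) ε hε
  have hop := Metric.tendsto_nhds.1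
    (((continuous_toeplitzOp_synthMat (T := T)).tendsto _).comp hlim) ε hε
  obtain ⟨m₀, hm₀⟩ := eventually_atTop.1 (htrunc.and (hcol.and hop))
  refine ⟨m₀, fun m hm => ?_⟩
  obtain ⟨⟨hunit_m, hy⟩, hcol_m, hop_m⟩ := hm₀ m hm
  rw [dist_eq_norm'] at hcol_m hop_m
  refine ⟨hunit_m, ⟨_, fun p => ?_, hcol_m⟩, _, _, isOperatorOf_toeplitzOp _, ?_, hop_m⟩
  · rw [colPhasor_synthMat, ← hy]
    rfl
  · exact truncFun_eq_synthMat hy ▸ isOperatorOf_toeplitzOp _
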